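/- For $n\ge 0$ let $Q_n$ be the hypercube graph: its vertex set is $\{0,1\}^n$, and two vertices are adjacent when they differ in exactly one coordinate. Write $e(G)$ for the number of edges of a graph $G$. For $m\ge 1$, a spanning subgraph $G$ of $Q_n$ is called $(Q_n,Q_m)$-saturated if it is a maximal $Q_m$-free subgraph of $Q_n$, that is, $G$ contains no (not necessarily induced) subgraph isomorphic to $Q_m$, but adding to $G$ any edge of $E(Q_n)\setminus E(G)$ creates one. Let $\mathrm{sat}(Q_n,Q_m)$ be the minimum of $e(G)$ over all $(Q_n,Q_m)$-saturated graphs $G$. Theorem. Put $a_1=1$ and $a_m=\dfrac{1}{7\cdot 3^{m-2}}$ for $m>1$. For every $m\ge 1$ there is a constant $c_m$, depending only on $m$, such that for all $n\ge 1$ $$\mathrm{sat}(Q_n,Q_m)\le \frac{c_m}{n^{a_m}}\, e(Q_n).$$ Consequently, for every fixed $m\ge 1$, $$\lim_{n\to\infty}\frac{\mathrm{sat}(Q_n,Q_m)}{e(Q_n)}=0.$$ (In particular, for $m=2$ the limit is $0$, and not $\tfrac14$ as conjectured by Santolupo.) -/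

import Mathlib

/-- The hypercube `Q_n`: vertex set `{0,1}^n`, two vertices being adjacent when they differ in
exactly one coordinate. -/
def hypercube (n : ℕ) : SimpleGraph (Fin n → Bool) where
  Adj x y := hammingDist x y = 1
  symm := ⟨fun x y h => by rwa [hammingDist_comm]⟩
  loopless := ⟨fun x h => by simp at h⟩

/-- `G` is `(H, F)`-saturated: it is a maximal `F`-free (spanning) subgraph of the host graph `H`.
Here `F`-free means that `G` has no (not necessarily induced) subgraph isomorphic to `F`. -/
def IsSaturated {V W : Type*} (H : SimpleGraph V) (F : SimpleGraph W) (G : SimpleGraph V) : Prop :=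
  Maximal (fun G' : SimpleGraph V => G' ≤ H ∧ F.Free G') G

/-- The number of edges of a finite graph. -/
noncomputable def numEdges {V : Type*} (G : SimpleGraph V) : ℕ := G.edgeSet.ncard

/-- The saturation number `sat(H, F)`: the minimum number of edges of an `(H, F)`-saturated
graph. -/
noncomputable def satNumber {V W : Type*} (H : SimpleGraph V) (F : SimpleGraph W) : ℕ :=
  sInf {e : ℕ | ∃ G : SimpleGraph V, IsSaturated H F G ∧ numEdges G = e}

/-- If `V` is finite and `F` has an edge, the set in the definition of `satNumber` is nonempty, so
that the saturation number is a genuine minimum. -/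
theorem exists_isSaturated {V W : Type*} [Finite V] (H : SimpleGraph V) (F : SimpleGraph W)
    (hF : F ≠ ⊥) : ∃ G : SimpleGraph V, IsSaturated H F G := by
  obtain ⟨G, -, hG⟩ := (Set.toFinite {G' : SimpleGraph V | G' ≤ H ∧ F.Free G'}).exists_le_maximal
    (show (⊥ : SimpleGraph V) ∈ _ from ⟨bot_le, SimpleGraph.free_bot hF⟩)
  exact ⟨G, hG⟩

/-- `Q_m` has an edge for `m ≥ 1`. -/
theorem hypercube_ne_bot {m : ℕ} (hm : 1 ≤ m) : hypercube m ≠ ⊥ := by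
  intro h
  have h1 : (hypercube m).Adj (fun _ => false) (fun i => decide (i = ⟨0, hm⟩)) := by
    simp [hypercube, hammingDist, Finset.filter_eq']
  rw [h] at h1
  exact h1

/-! Put `q = m - 1` and place `2q` Hamming codes, `q` in each of two colours, on disjoint blocks of
`2 ^ t - 1` coordinates. `C.graph` is `Q_{q+1}`-free (`graph_free`), yet at a vertex seeing no
codeword, adding any edge in a direction outside the blocks completes a `Q_{q+1}`
(`isContained_of_add`): each block of the right colour has a codeword one flip away, since the codes
are perfect. Hence every edge of a saturated extension lies in a block direction or has an end that
sees a codeword. There are at most `2q * 2 ^ n * (2 ^ t + n / 2 ^ t)` such pairs (vertex,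
direction), and `2 ^ t` of order `√n` gives `O(e(Q_n) / √n)`. The exponent `1/2` is at least `a_m`
for `m ≥ 2`, while for `m = 1` the bound is zero. -/

/-! ### Coordinate flips and subcubes. -/

/-- Flip the `i`-th coordinate of a vertex of the hypercube. -/
def flipAt {n : ℕ} (i : Fin n) (x : Fin n → Bool) : Fin n → Bool :=
  fun j => if j = i then !x j else x j

theorem flipAt_same {n : ℕ} (i : Fin n) (x : Fin n → Bool) : flipAt i x i = !x i := by
  simp [flipAt]

theorem flipAt_of_ne {n : ℕ} {i j : Fin n} (h : j ≠ i) (x : Fin n → Bool) :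
    flipAt i x j = x j := by
  simp [flipAt, h]

theorem flipAt_flipAt {n : ℕ} (i : Fin n) (x : Fin n → Bool) : flipAt i (flipAt i x) = x := by
  funext j
  by_cases h : j = i <;> simp [flipAt, h]

theorem flipAt_comm {n : ℕ} (i j : Fin n) (x : Fin n → Bool) :
    flipAt i (flipAt j x) = flipAt j (flipAt i x) := by
  funext k
  unfold flipAt
  split_ifs <;> rfl

theorem flipAt_left_injective {n : ℕ} (x : Fin n → Bool) :
    Function.Injective fun i => flipAt i x := by
  intro i j h
  by_contra hij
  have := congrFun h i
  simp [flipAt, hij] at this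

theorem flipAt_ne {n : ℕ} (i : Fin n) (x : Fin n → Bool) : flipAt i x ≠ x := by
  intro h
  have := congrFun h i
  simp [flipAt] at this

theorem hypercube_adj_iff {n : ℕ} {x y : Fin n → Bool} :
    (hypercube n).Adj x y ↔ ∃ i, y = flipAt i x := by
  change hammingDist x y = 1 ↔ _
  rw [hammingDist, Finset.card_eq_one]
  refine exists_congr fun i => ?_
  constructor
  · intro h
    funext j
    have hj := Finset.ext_iff.1 h j
    simp only [Finset.mem_filter, Finset.mem_univ, true_and, Finset.mem_singleton] at hj
    by_cases hji : j = i
    · have := hj.2 hji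
      simp only [flipAt, hji, if_true] at this ⊢
      revert this
      cases x i <;> cases y i <;> simp
    · simp only [flipAt, hji, if_false]
      by_contra h'
      exact hji (hj.1 (Ne.symm h'))
  · rintro rfl
    ext j
    by_cases hji : j = i <;> simp [flipAt, hji]

/-- Induction along flips of single coordinates, starting at the zero vertex. -/
theorem flipAt_induction {n : ℕ} {p : (Fin n → Bool) → Prop} (h0 : p fun _ => false)
    (hs : ∀ u a, p u → p (flipAt a u)) (u : Fin n → Bool) : p u := by
  have key : ∀ S : Finset (Fin n), p fun a => decide (a ∈ S) := by
    intro S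
    induction S using Finset.induction with
    | empty => simpa using h0
    | insert a S ha ih =>
      convert hs _ a ih using 1
      funext b
      by_cases hb : b = a
      · subst hb; simp [flipAt, ha]
      · simp [flipAt, hb]
  convert key (Finset.univ.filter fun a => u a = true)
  simp

/-- An injective homomorphism between hypercubes is the parametrisation of a subcube. -/
theorem exists_directions {m n : ℕ} {f : (Fin m → Bool) → (Fin n → Bool)}
    (hf : Function.Injective f)
    (hadj : ∀ u a, (hypercube n).Adj (f u) (f (flipAt a u))) :
    ∃ d : Fin m → Fin n, Function.Injective d ∧ ∀ u a, f (flipAt a u) = flipAt (d a) (f u) := by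
  have h1 : ∀ u a, ∃ i, f (flipAt a u) = flipAt i (f u) :=
    fun u a => hypercube_adj_iff.1 (hadj u a)
  choose D hD using h1
  have hinj : ∀ u, Function.Injective (D u) := by
    intro u a b hab
    have : f (flipAt a u) = f (flipAt b u) := by rw [hD, hD, hab]
    exact flipAt_left_injective u (hf this)
  -- Opposite edges of a square have the same direction: compare the two paths to the opposite
  -- corner at the coordinate `D u a`.
  have hstep : ∀ u b a, D (flipAt b u) a = D u a := by
    intro u b a
    by_cases hab : a = b
    · subst hab
      have h := hD (flipAt a u) a
      rw [flipAt_flipAt, hD u a] at h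
      have h2 : flipAt (D u a) (flipAt (D u a) (f u)) =
          flipAt (D (flipAt a u) a) (flipAt (D u a) (f u)) := by
        rw [flipAt_flipAt]; exact h
      exact (flipAt_left_injective _ h2).symm
    · have hne : D u a ≠ D u b := fun h => hab (hinj u h)
      have e1 := hD (flipAt b u) a
      have e2 := hD (flipAt a u) b
      rw [hD u b] at e1
      rw [hD u a] at e2
      rw [flipAt_comm b a] at e2
      have hpq : D (flipAt a u) b ≠ D u a := by
        intro h
        rw [h, flipAt_flipAt] at e2
        have h3 := hf e2
        have h4 := congrFun h3 a
        simp [flipAt, hab] at h4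
      have e3 := congrFun (e1.symm.trans e2) (D u a)
      by_contra hc
      rw [flipAt_of_ne (Ne.symm hc), flipAt_of_ne hne, flipAt_of_ne hpq.symm, flipAt_same] at e3
      simp at e3
  have hconst : ∀ u a, D u a = D (fun _ => false) a := by
    intro u
    induction u using flipAt_induction with
    | h0 => intro a; rfl
    | hs u b ih => intro a; rw [hstep, ih]
  exact ⟨D fun _ => false, hinj _, fun u a => by rw [hD, hconst]⟩

/-- The subcube through `x` spanned by the directions `d`. -/
def subcube {m n : ℕ} (x : Fin n → Bool) (d : Fin m → Fin n) (u : Fin m → Bool) :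
    Fin n → Bool :=
  fun i => xor (x i) (decide (∃ a, d a = i ∧ u a = true))

theorem subcube_false {m n : ℕ} (x : Fin n → Bool) (d : Fin m → Fin n) :
    subcube x d (fun _ => false) = x := by
  funext i; simp [subcube]

theorem subcube_apply {m n : ℕ} (x : Fin n → Bool) {d : Fin m → Fin n}
    (hd : Function.Injective d) (u : Fin m → Bool) (a : Fin m) :
    subcube x d u (d a) = xor (x (d a)) (u a) := by
  have : (∃ b, d b = d a ∧ u b = true) ↔ u a = true :=
    ⟨fun ⟨b, hb, h⟩ => hd hb ▸ h, fun h => ⟨a, rfl, h⟩⟩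
  simp [subcube, this]

theorem subcube_injective {m n : ℕ} (x : Fin n → Bool) {d : Fin m → Fin n}
    (hd : Function.Injective d) : Function.Injective (subcube x d) := by
  intro u v h
  funext a
  have := congrFun h (d a)
  rw [subcube_apply x hd, subcube_apply x hd] at this
  simpa using this

theorem subcube_flipAt {m n : ℕ} (x : Fin n → Bool) {d : Fin m → Fin n}
    (hd : Function.Injective d) (u : Fin m → Bool) (a : Fin m) :
    subcube x d (flipAt a u) = flipAt (d a) (subcube x d u) := by
  funext i
  by_cases hi : ∃ b, d b = i
  · obtain ⟨b, rfl⟩ := hi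
    rw [subcube_apply x hd]
    by_cases hb : b = a
    · subst hb
      rw [flipAt_same, flipAt_same, subcube_apply x hd]; simp
    · rw [flipAt_of_ne hb, flipAt_of_ne (fun h => hb (hd h)), subcube_apply x hd]
  · push Not at hi
    rw [flipAt_of_ne (hi a).symm]
    simp [subcube, hi]

/-! ### Hamming blocks, syndromes and parity. -/

/-- A family of Hamming codes on disjoint blocks of coordinates of `{0,1}^n`. The blocks are indexed
by `Bool × Fin q`; `kind i` is the block of the coordinate `i`, if any, and `vec i` the
corresponding column of the parity check matrix. -/
structure CodeFamily (n q : ℕ) (V : Type*) [AddCommGroup V] where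
  kind : Fin n → Option (Bool × Fin q)
  vec : Fin n → V
  add_self : ∀ v : V, v + v = 0
  vec_ne_zero : ∀ {i k}, kind i = some k → vec i ≠ 0
  vec_injOn : ∀ {i j k}, kind i = some k → kind j = some k → vec i = vec j → i = j
  exists_vec : ∀ k, ∀ v ≠ 0, ∃ i, kind i = some k ∧ vec i = v

namespace CodeFamily

variable {n q : ℕ} {V : Type*} [AddCommGroup V] (C : CodeFamily n q V)

/-- The syndrome of `x` with respect to the code on block `k`. -/
def syn (x : Fin n → Bool) (k : Bool × Fin q) : V :=
  ∑ i, if C.kind i = some k ∧ x i = true then C.vec i else 0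

theorem syn_flipAt_of_ne {i : Fin n} {k : Bool × Fin q} (h : C.kind i ≠ some k)
    (x : Fin n → Bool) : C.syn (flipAt i x) k = C.syn x k := by
  refine Finset.sum_congr rfl fun j _ => ?_
  by_cases hj : j = i
  · subst hj; simp [h]
  · rw [flipAt_of_ne hj]

theorem syn_flipAt {i : Fin n} {k : Bool × Fin q} (h : C.kind i = some k)
    (x : Fin n → Bool) : C.syn (flipAt i x) k = C.syn x k + C.vec i := by
  unfold syn
  rw [← Finset.add_sum_erase _ _ (Finset.mem_univ i),
    ← Finset.add_sum_erase Finset.univ (fun j => if C.kind j = some k ∧ x j = true then C.vec j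
      else 0) (Finset.mem_univ i)]
  have hs : ∀ j ∈ Finset.univ.erase i,
      (if C.kind j = some k ∧ flipAt i x j = true then C.vec j else 0) =
        if C.kind j = some k ∧ x j = true then C.vec j else 0 := by
    intro j hj
    rw [flipAt_of_ne (Finset.ne_of_mem_erase hj)]
  rw [Finset.sum_congr rfl hs, flipAt_same]
  cases hx : x i
  · simp [h, add_comm]
  · simp only [h, Bool.not_true, Bool.false_eq_true, and_false, if_false, and_self, if_true]
    rw [add_right_comm, C.add_self]

/-- The parity of the number of ones of `x` among the coordinates other than `i` that lie in
no block. -/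
def par (i : Fin n) (x : Fin n → Bool) : Bool :=
  decide (Odd (Finset.univ.filter fun j => j ≠ i ∧ C.kind j = none ∧ x j = true).card)

theorem par_flipAt_self (i : Fin n) (x : Fin n → Bool) : C.par i (flipAt i x) = C.par i x := by
  unfold par
  congr 4
  ext j
  by_cases hj : j = i
  · simp [hj]
  · rw [flipAt_of_ne hj]

theorem par_flipAt_of_ne {i j : Fin n} (h : C.kind j ≠ none) (x : Fin n → Bool) :
    C.par i (flipAt j x) = C.par i x := by
  unfold par
  congr 4
  ext l
  by_cases hl : l = j
  · subst hl; simp [h]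
  · rw [flipAt_of_ne hl]

theorem par_flipAt {i j : Fin n} (hij : j ≠ i) (h : C.kind j = none) (x : Fin n → Bool) :
    C.par i (flipAt j x) = !C.par i x := by
  unfold par
  have key : ∀ y : Fin n → Bool, y j = false →
      (Finset.univ.filter fun l => l ≠ i ∧ C.kind l = none ∧ flipAt j y l = true).card =
      (Finset.univ.filter fun l => l ≠ i ∧ C.kind l = none ∧ y l = true).card + 1 := by
    intro y hy
    rw [← Finset.card_insert_of_notMem (a := j) (by simp [hy])]
    congr 1
    ext l
    by_cases hl : l = j
    · subst hl; simp [flipAt, hy, h, hij]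
    · simp [flipAt_of_ne hl, hl]
  cases hx : x j
  · rw [key x hx, Bool.eq_iff_iff]
    simp [Nat.odd_add_one]
  · have := key (flipAt j x) (by rw [flipAt_same, hx]; rfl)
    rw [flipAt_flipAt] at this
    rw [this, Bool.eq_iff_iff]
    simp [Nat.odd_add_one]

/-! ### The graph and its cube-freeness. -/

/-- The condition for the edge in direction `i` at `x` to belong to `C.graph`. In a block, it is
that the edge joins a codeword of that block to a non-codeword, no block of the other
colour seeing a codeword. Outside the blocks, it is that codewords are seen in the colour given by
the parity of the edge, and in no other. -/
def IsEdge (i : Fin n) (x : Fin n → Bool) : Prop :=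
  (C.kind i = none ∧ (∃ j, C.syn x (C.par i x, j) = 0) ∧ ∀ j, C.syn x (!C.par i x, j) ≠ 0) ∨
  ∃ s j, C.kind i = some (s, j) ∧ (∀ j', C.syn x (!s, j') ≠ 0) ∧
    (C.syn x (s, j) = 0 ∨ C.syn x (s, j) + C.vec i = 0)

theorem isEdge_of_none {i : Fin n} (h : C.kind i = none) (x : Fin n → Bool) :
    C.IsEdge i x ↔
      (∃ j, C.syn x (C.par i x, j) = 0) ∧ ∀ j, C.syn x (!C.par i x, j) ≠ 0 := by
  simp [IsEdge, h]

theorem isEdge_of_some {i : Fin n} {s : Bool} {j : Fin q} (h : C.kind i = some (s, j))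
    (x : Fin n → Bool) :
    C.IsEdge i x ↔ (∀ j', C.syn x (!s, j') ≠ 0) ∧
      (C.syn x (s, j) = 0 ∨ C.syn x (s, j) + C.vec i = 0) := by
  constructor
  · rintro (⟨h', -⟩ | ⟨s', j', h', h''⟩)
    · simp [h] at h'
    · rw [h] at h'
      obtain ⟨rfl, rfl⟩ := Prod.mk.inj (Option.some.inj h')
      exact h''
  · exact fun h' => Or.inr ⟨s, j, h, h'⟩

theorem isEdge_flipAt {i : Fin n} {x : Fin n → Bool} (h : C.IsEdge i x) :
    C.IsEdge i (flipAt i x) := by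
  cases hk : C.kind i with
  | none =>
    rw [isEdge_of_none C hk] at h ⊢
    simpa [par_flipAt_self, syn_flipAt_of_ne, hk] using h
  | some k =>
    obtain ⟨s, j⟩ := k
    rw [isEdge_of_some C hk] at h ⊢
    rw [syn_flipAt C hk, add_assoc, C.add_self, add_zero]
    refine ⟨fun j' => ?_, h.2.symm⟩
    rw [syn_flipAt_of_ne C (by simp [hk])]
    exact h.1 j'

/-- The subgraph of the hypercube given by `C.IsEdge`. -/
def graph : SimpleGraph (Fin n → Bool) where
  Adj x y := ∃ i, y = flipAt i x ∧ C.IsEdge i x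
  symm := ⟨by
    rintro x y ⟨i, rfl, h⟩
    exact ⟨i, (flipAt_flipAt i x).symm, C.isEdge_flipAt h⟩⟩
  loopless := ⟨by
    rintro x ⟨i, h, -⟩
    exact flipAt_ne i x h.symm⟩

theorem graph_adj_flipAt {i : Fin n} {x : Fin n → Bool} :
    C.graph.Adj x (flipAt i x) ↔ C.IsEdge i x := by
  constructor
  · rintro ⟨j, h, hj⟩
    rwa [flipAt_left_injective x h]
  · exact fun h => ⟨i, rfl, h⟩

theorem graph_le : C.graph ≤ hypercube n := by
  rintro x y ⟨i, h, -⟩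
  exact hypercube_adj_iff.2 ⟨i, h⟩

/-- Two directions of a subcube of `C.graph` do not lie in the same block. -/
theorem kind_ne_of_square {m : ℕ} {f : (Fin m → Bool) → Fin n → Bool} {d : Fin m → Fin n}
    (hd : Function.Injective d) (hf : ∀ u a, f (flipAt a u) = flipAt (d a) (f u))
    (hE : ∀ u a, C.IsEdge (d a) (f u)) {a b : Fin m} (hab : a ≠ b) {k : Bool × Fin q}
    (ha : C.kind (d a) = some k) : C.kind (d b) ≠ some k := by
  intro hb
  obtain ⟨s, j⟩ := k
  have hv : C.vec (d a) ≠ C.vec (d b) := fun h => hab (hd (C.vec_injOn ha hb h))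
  set u : Fin m → Bool := fun _ => false
  have h1 := ((C.isEdge_of_some ha _).1 (hE u a)).2
  have h2 := ((C.isEdge_of_some ha _).1 (hE (flipAt b u) a)).2
  have h3 := ((C.isEdge_of_some hb _).1 (hE u b)).2
  have h4 := ((C.isEdge_of_some hb _).1 (hE (flipAt a u) b)).2
  rw [hf, C.syn_flipAt hb] at h2
  rw [hf, C.syn_flipAt ha] at h4
  have hva := C.vec_ne_zero ha
  have hvb := C.vec_ne_zero hb
  have hab0 : C.vec (d a) + C.vec (d b) ≠ 0 := fun h =>
    hv (add_right_cancel (h.trans (C.add_self (C.vec (d b))).symm))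
  generalize C.syn (f u) (s, j) = z at *
  -- The four corners of the square have distinct syndromes, so at most one is a codeword; it cannot
  -- meet all four edges.
  rcases h1 with rfl | h1
  · simp only [zero_add] at h2 h4
    rcases h2 with h2 | h2
    · exact hvb h2
    · exact hab0 (by rwa [add_comm])
  · rcases h3 with rfl | h3
    · exact hva (by simpa using h1)
    · exact hv (add_left_cancel (h1.trans h3.symm))

/-- A cube with a direction outside the blocks has its other `q` directions in all the blocks of one
colour, so one can walk to a vertex seeing no codeword, where the outside edge is missing. A cube
with block directions only must use both colours, and a codeword of one colour forbids block edges
of the other. -/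
theorem graph_free : (hypercube (q + 1)).Free C.graph := by
  rintro ⟨F⟩
  have hadj : ∀ u a, C.graph.Adj (F u) (F (flipAt a u)) := fun u a =>
    F.toHom.map_adj (hypercube_adj_iff.2 ⟨a, rfl⟩)
  obtain ⟨d, hd, hf⟩ := exists_directions (f := F) F.injective
    fun u a => C.graph_le (hadj u a)
  have hE : ∀ u a, C.IsEdge (d a) (F u) := fun u a => by
    rw [← graph_adj_flipAt, ← hf]; exact hadj u a
  have hblock := @kind_ne_of_square _ _ _ _ C _ _ _ hd hf hE
  generalize (F : (Fin (q + 1) → Bool) → Fin n → Bool) = f at hf hE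
  by_cases hB : ∃ b, C.kind (d b) = none
  · obtain ⟨b, hb⟩ := hB
    have hbE := fun u => (C.isEdge_of_none hb (f u)).1 (hE u b)
    set u₀ : Fin (q + 1) → Bool := fun _ => false
    have hother : ∀ a, a ≠ b → ∃ s j, C.kind (d a) = some (s, j) := by
      intro a hab
      cases hk : C.kind (d a) with
      | some k => exact ⟨k.1, k.2, rfl⟩
      | none =>
        -- A second direction outside the blocks would flip the parity without changing any
        -- syndrome, swapping the required colour.
        have h1 := hbE (flipAt a u₀)
        rw [hf, C.par_flipAt (fun h => hab (hd h)) hk] at h1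
        obtain ⟨⟨j, hj⟩, -⟩ := h1
        rw [C.syn_flipAt_of_ne (by simp [hk])] at hj
        exact absurd hj ((hbE u₀).2 j)
    have hpar : ∀ u, C.par (d b) (f u) = C.par (d b) (f u₀) := by
      intro u
      induction u using flipAt_induction with
      | h0 => rfl
      | hs u a ih =>
        rw [hf]
        by_cases hab : a = b
        · subst hab; rw [C.par_flipAt_self, ih]
        · obtain ⟨s, j, h⟩ := hother a hab
          rw [C.par_flipAt_of_ne (by simp [h]), ih]
    set s₀ := C.par (d b) (f u₀)
    have hcol : ∀ a, a ≠ b → ∃ j, C.kind (d a) = some (s₀, j) := by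
      intro a hab
      obtain ⟨s, j, h⟩ := hother a hab
      obtain ⟨j', hj'⟩ := (hbE u₀).1
      have h1 := ((C.isEdge_of_some h _).1 (hE u₀ a)).1 j'
      have hs : s = s₀ := by
        by_contra hne
        have : (!s) = s₀ := by
          revert hne; cases s <;> cases s₀ <;> simp
        rw [this] at h1
        exact h1 hj'
      exact ⟨j, hs ▸ h⟩
    have : Nonempty (Fin q) := ⟨(hbE u₀).1.choose⟩
    choose! J hJ using hcol
    have hsurj : ∀ j, ∃ a, a ≠ b ∧ C.kind (d a) = some (s₀, j) := by
      have hinj : Function.Injective fun a : {a // a ≠ b} => J a.1 := by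
        intro a a' h
        by_contra hne
        refine hblock (fun h' => hne (Subtype.ext h')) (hJ a.1 a.2) ?_
        rw [hJ a'.1 a'.2]
        simp only at h
        rw [h]
      have hbij := (Fintype.bijective_iff_injective_and_card _).2
        ⟨hinj, by simp [Fintype.card_subtype_compl]⟩
      intro j
      obtain ⟨⟨a, ha⟩, rfl⟩ := hbij.2 j
      exact ⟨a, ha, hJ a ha⟩
    classical
    -- At a vertex seeing the fewest codewords of colour `s₀`, the edge in direction `d b` still
    -- requires one; flipping the cube's direction in that block destroys it and creates no other.
    obtain ⟨u, -, hu⟩ := Finset.exists_min_image Finset.univ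
      (fun u => (Finset.univ.filter fun j => C.syn (f u) (s₀, j) = 0).card)
      ⟨u₀, Finset.mem_univ u₀⟩
    obtain ⟨j, hj⟩ := (hbE u).1
    rw [hpar] at hj
    obtain ⟨a, -, ha⟩ := hsurj j
    refine absurd (hu (flipAt a u) (Finset.mem_univ _)) (not_le.2 (Finset.card_lt_card ?_))
    rw [Finset.ssubset_iff_of_subset]
    · refine ⟨j, by simpa using hj, ?_⟩
      rw [Finset.mem_filter, hf, C.syn_flipAt ha, hj, zero_add]
      exact fun h => C.vec_ne_zero ha h.2
    · intro l
      simp only [Finset.mem_filter, Finset.mem_univ, true_and]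
      intro hl
      by_cases hlj : l = j
      · rwa [hlj]
      · rwa [hf, C.syn_flipAt_of_ne (by rw [ha]; simp [Ne.symm hlj])] at hl
  · push Not at hB
    have hsome : ∀ a, ∃ s j, C.kind (d a) = some (s, j) := by
      intro a
      obtain ⟨⟨s, j⟩, h⟩ := Option.ne_none_iff_exists'.1 (hB a)
      exact ⟨s, j, h⟩
    choose S J hk using hsome
    -- Directions sharing an index lie in distinct blocks, hence have opposite colours.
    obtain ⟨a, b, hab, hJ⟩ := Fintype.exists_ne_map_eq_of_card_lt J (by simp)
    have hS : S b = !S a := by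
      by_contra hne
      have h : S a = S b := by
        revert hne; cases S a <;> cases S b <;> simp
      refine hblock hab (hk a) ?_
      rw [hk b, h, hJ]
    set u₀ : Fin (q + 1) → Bool := fun _ => false
    have h1 := ((C.isEdge_of_some (hk a) _).1 (hE u₀ a)).1 (J b)
    have h2 := ((C.isEdge_of_some (hk a) _).1 (hE (flipAt b u₀) a)).1 (J b)
    have h3 := ((C.isEdge_of_some (hk b) _).1 (hE u₀ b)).2
    rw [← hS] at h1 h2
    rw [hf, C.syn_flipAt (hk b)] at h2
    exact h3.elim h1 h2

/-! ### Saturation and the count of exceptional edges. -/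

theorem isContained_of_add {G : SimpleGraph (Fin n → Bool)} (hG : C.graph ≤ G)
    {x : Fin n → Bool} {i : Fin n} (hi : C.kind i = none) (hx : ∀ k, C.syn x k ≠ 0)
    (hxi : G.Adj x (flipAt i x)) : (hypercube (q + 1)).IsContained G := by
  set s := C.par i x
  -- Flipping `g j` moves `x` to a codeword of block `(s, j)`.
  choose g hg hgv using fun j => C.exists_vec (s, j) (C.syn x (s, j)) (hx _)
  set d : Fin (q + 1) → Fin n := Fin.cons i g with hd'
  have hginj : Function.Injective g := by
    intro j j' h
    have := (hg j).symm.trans (h ▸ hg j')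
    simpa using this
  have hd : Function.Injective d := by
    rw [hd', Fin.cons_injective_iff]
    refine ⟨?_, hginj⟩
    rintro ⟨j, hj⟩
    have := hg j
    rw [hj, hi] at this
    simp at this
  set φ := subcube x d
  have hφ : ∀ u a, φ (flipAt a u) = flipAt (d a) (φ u) := subcube_flipAt x hd
  have hinv : ∀ u, C.par i (φ u) = s ∧ (∀ j, C.syn (φ u) (!s, j) = C.syn x (!s, j)) ∧
      ∀ j, C.syn (φ u) (s, j) = if u j.succ = true then 0 else C.syn x (s, j) := by
    intro u
    induction u using flipAt_induction with
    | h0 =>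
      simp only [φ, subcube_false]
      simp [s]
    | hs u a ih =>
      obtain ⟨ih1, ih2, ih3⟩ := ih
      rw [hφ]
      cases a using Fin.cases with
      | zero =>
        simp only [hd', Fin.cons_zero]
        refine ⟨by rw [C.par_flipAt_self, ih1], fun j => ?_, fun j => ?_⟩
        · rw [C.syn_flipAt_of_ne (by simp [hi]), ih2]
        · rw [C.syn_flipAt_of_ne (by simp [hi]), ih3, flipAt_of_ne (Fin.succ_ne_zero j)]
      | succ l =>
        simp only [hd', Fin.cons_succ]
        refine ⟨by rw [C.par_flipAt_of_ne (by simp [hg]), ih1], fun j => ?_, fun j => ?_⟩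
        · rw [C.syn_flipAt_of_ne (by simp [hg]), ih2]
        · by_cases hlj : j = l
          · subst hlj
            rw [C.syn_flipAt (hg j), ih3, hgv, flipAt_same]
            cases u j.succ <;> simp [C.add_self]
          · rw [C.syn_flipAt_of_ne (by simp [hg, Ne.symm hlj]), ih3,
              flipAt_of_ne (by simpa using hlj)]
  have hstep : ∀ u a, G.Adj (φ u) (φ (flipAt a u)) := by
    intro u a
    obtain ⟨h1, h2, h3⟩ := hinv u
    cases a using Fin.cases with
    | zero =>
      -- Once some `g j` is flipped, a codeword of colour `s` is seen; only the edge at `x` itself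
      -- needs `hxi`.
      by_cases hu : ∃ j : Fin q, u j.succ = true
      · rw [hφ]
        refine hG (C.graph_adj_flipAt.2 ?_)
        rw [hd', Fin.cons_zero, C.isEdge_of_none hi, h1]
        obtain ⟨j, hj⟩ := hu
        exact ⟨⟨j, by rw [h3, if_pos hj]⟩, fun j => by rw [h2]; exact hx _⟩
      · push Not at hu
        have h00 : φ (fun _ => false) = x := subcube_false x d
        have h01 : φ (flipAt 0 fun _ => false) = flipAt i x := by rw [hφ, h00, hd', Fin.cons_zero]
        cases h0 : u 0
        · have : u = fun _ => false := by
            funext a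
            cases a using Fin.cases with
            | zero => exact h0
            | succ j => simpa using hu j
          rw [this, h00, h01]
          exact hxi
        · have : u = flipAt 0 fun _ => false := by
            funext a
            cases a using Fin.cases with
            | zero => simpa [flipAt] using h0
            | succ j => simpa [flipAt] using hu j
          rw [this, flipAt_flipAt, h00, h01]
          exact hxi.symm
    | succ l =>
      rw [hφ]
      refine hG (C.graph_adj_flipAt.2 ?_)
      rw [hd', Fin.cons_succ, C.isEdge_of_some (hg l), h3, hgv]
      refine ⟨fun j => by rw [h2]; exact hx _, ?_⟩
      cases u l.succ <;> simp [C.add_self]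
  refine ⟨⟨⟨φ, ?_⟩, subcube_injective x hd⟩⟩
  intro u v huv
  obtain ⟨a, rfl⟩ := hypercube_adj_iff.1 huv
  exact hstep u a

/-- The pairs `(x, i)` such that the edge in direction `i` at `x` may belong to a saturated graph
extending `C.graph`. -/
def exceptional : Set ((Fin n → Bool) × Fin n) :=
  {p | C.kind p.2 ≠ none ∨ ∃ k, C.syn p.1 k = 0}

theorem satNumber_le_ncard_exceptional :
    satNumber (hypercube n) (hypercube (q + 1)) ≤ C.exceptional.ncard := by
  obtain ⟨G, hle, hG⟩ := (Set.toFinite {G' : SimpleGraph (Fin n → Bool) |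
    G' ≤ hypercube n ∧ (hypercube (q + 1)).Free G'}).exists_le_maximal
    (show C.graph ∈ _ from ⟨C.graph_le, C.graph_free⟩)
  have hsat : satNumber (hypercube n) (hypercube (q + 1)) ≤ numEdges G :=
    Nat.sInf_le ⟨G, hG, rfl⟩
  refine hsat.trans ?_
  have hsub : G.edgeSet ⊆ (fun p => s(p.1, flipAt p.2 p.1)) '' C.exceptional := by
    intro e
    induction e using Sym2.ind with
    | _ x y =>
      intro hxy
      rw [SimpleGraph.mem_edgeSet] at hxy
      obtain ⟨i, rfl⟩ := hypercube_adj_iff.1 (hG.prop.1 hxy)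
      refine ⟨(x, i), ?_, rfl⟩
      by_contra hne
      simp only [exceptional, Set.mem_ofPred_eq, not_or, not_exists, not_not] at hne
      exact hG.prop.2 (C.isContained_of_add hle hne.1 hne.2 hxy)
  exact (Set.ncard_le_ncard hsub (Set.toFinite _)).trans (Set.ncard_image_le (Set.toFinite _))

/-- Flipping the coordinate with column `v` matches the fibre of the syndrome over `v` with the
fibre over `0`, so all fibres have equal size. -/
theorem card_syn_eq_zero_mul [Fintype V] [DecidableEq V] (k : Bool × Fin q) :
    (Finset.univ.filter fun x => C.syn x k = 0).card * Fintype.card V = 2 ^ n := by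
  have hfib : ∀ v : V, (Finset.univ.filter fun x => C.syn x k = v).card =
      (Finset.univ.filter fun x => C.syn x k = 0).card := by
    intro v
    by_cases hv : v = 0
    · rw [hv]
    · obtain ⟨i, hi, rfl⟩ := C.exists_vec k v hv
      refine Finset.card_bij' (fun x _ => flipAt i x) (fun x _ => flipAt i x) ?_ ?_
        (fun x _ => flipAt_flipAt i x) (fun x _ => flipAt_flipAt i x)
      · intro x hx
        simp only [Finset.mem_filter, Finset.mem_univ, true_and] at hx ⊢
        rw [C.syn_flipAt hi, hx, C.add_self]
      · intro x hx
        simp only [Finset.mem_filter, Finset.mem_univ, true_and] at hx ⊢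
        rw [C.syn_flipAt hi, hx, zero_add]
  have h := Finset.card_eq_sum_card_fiberwise (s := (Finset.univ : Finset (Fin n → Bool)))
    (t := (Finset.univ : Finset V)) (f := fun x => C.syn x k) (by intro x _; simp)
  simp only [hfib, Finset.sum_const, Finset.card_univ, smul_eq_mul] at h
  rw [mul_comm, ← h]
  simp

theorem card_kind_ne_none_le [Fintype V] :
    (Finset.univ.filter fun i => C.kind i ≠ none).card ≤ 2 * q * Fintype.card V := by
  classical
  have hsub : ((Finset.univ.filter fun i => C.kind i ≠ none).image fun i => (C.kind i, C.vec i)) ⊆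
      (Finset.univ.image some) ×ˢ Finset.univ := by
    intro p hp
    obtain ⟨i, hi, rfl⟩ := Finset.mem_image.1 hp
    obtain ⟨k, hk⟩ := Option.ne_none_iff_exists'.1 (Finset.mem_filter.1 hi).2
    simp [hk]
  have hinj : Set.InjOn (fun i => (C.kind i, C.vec i))
      (Finset.univ.filter fun i => C.kind i ≠ none) := by
    intro i hi j hj h
    obtain ⟨k, hk⟩ := Option.ne_none_iff_exists'.1 (Finset.mem_filter.1 hi).2
    obtain ⟨h1, h2⟩ := Prod.mk.inj h
    exact C.vec_injOn hk (h1 ▸ hk) h2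
  rw [← Finset.card_image_of_injOn hinj]
  refine (Finset.card_le_card hsub).trans ?_
  rw [Finset.card_product, Finset.card_image_of_injective _ (Option.some_injective _)]
  simp

theorem ncard_exceptional_le [Fintype V] :
    (C.exceptional.ncard : ℝ) ≤
      2 * q * 2 ^ n * (Fintype.card V + n / Fintype.card V) := by
  classical
  set N := Fintype.card V
  have hNpos : (0 : ℝ) < N := by
    exact_mod_cast Fintype.card_pos_iff.2 ⟨(0 : V)⟩
  let S : Finset ((Fin n → Bool) × Fin n) :=
    Finset.univ ×ˢ (Finset.univ.filter fun i => C.kind i ≠ none) ∪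
      Finset.univ.biUnion fun k => (Finset.univ.filter fun x => C.syn x k = 0) ×ˢ Finset.univ
  have hsub : C.exceptional ⊆ S := by
    rintro ⟨x, i⟩ (h | ⟨k, hk⟩)
    · simp only at h
      simp [S, h]
    · simp only at hk
      simp only [S, Finset.coe_union, Set.mem_union, Finset.mem_coe, Finset.mem_biUnion]
      exact Or.inr ⟨k, Finset.mem_univ k, by simp [hk]⟩
  have h1 : C.exceptional.ncard ≤ S.card := by
    rw [← Set.ncard_coe_finset]
    exact Set.ncard_le_ncard hsub (Set.toFinite _)
  have hsyn : ∀ k, ((Finset.univ.filter fun x => C.syn x k = 0).card : ℝ) = 2 ^ n / N := by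
    intro k
    rw [eq_div_iff hNpos.ne']
    exact_mod_cast C.card_syn_eq_zero_mul k
  have h2 : (S.card : ℝ) ≤ 2 ^ n * (2 * q * N) + ∑ _k : Bool × Fin q, (2 : ℝ) ^ n / N * n := by
    have h3 : S.card ≤ 2 ^ n * (2 * q * N) + ∑ k : Bool × Fin q,
        (Finset.univ.filter fun x => C.syn x k = 0).card * n := by
      refine (Finset.card_union_le _ _).trans (add_le_add ?_ ?_)
      · rw [Finset.card_product]
        refine Nat.mul_le_mul (by simp) C.card_kind_ne_none_le
      · refine Finset.card_biUnion_le.trans (Finset.sum_le_sum fun k _ => ?_)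
        rw [Finset.card_product]
        simp
    have h4 : (S.card : ℝ) ≤ ((2 ^ n * (2 * q * N) + ∑ k : Bool × Fin q,
        (Finset.univ.filter fun x => C.syn x k = 0).card * n : ℕ) : ℝ) := by exact_mod_cast h3
    push_cast at h4
    simpa only [hsyn] using h4
  refine (Nat.cast_le.2 h1).trans (h2.trans (le_of_eq ?_))
  simp only [Finset.sum_const, Finset.card_univ, Fintype.card_prod, Fintype.card_bool,
    Fintype.card_fin, nsmul_eq_mul]
  push_cast
  ring

/-- Hamming codes with `t` check bits exist on disjoint blocks as soon as there is room. -/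
theorem nonempty_of_card_le {n q t : ℕ} (h : 2 * q * 2 ^ t ≤ n) :
    Nonempty (CodeFamily n q (Fin t → ZMod 2)) := by
  classical
  have hcard : Fintype.card ((Bool × Fin q) × {v : Fin t → ZMod 2 // v ≠ 0}) ≤
      Fintype.card (Fin n) := by
    refine le_trans ?_ ((h.trans_eq (Fintype.card_fin n).symm))
    rw [Fintype.card_prod, Fintype.card_prod, Fintype.card_bool, Fintype.card_fin]
    refine Nat.mul_le_mul_left _ ((Fintype.card_subtype_le _).trans ?_)
    simp
  obtain ⟨g⟩ := Function.Embedding.nonempty_of_card_le hcard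
  have hg : ∀ i p, Function.partialInv g i = some p ↔ g p = i := fun i p =>
    Function.Injective.isPartialInv g.injective p i
  -- Coordinates missed by `g` belong to no block; their default column `0` is irrelevant.
  refine ⟨{
    kind := fun i => (Function.partialInv g i).map Prod.fst
    vec := fun i => ((Function.partialInv g i).map fun p => p.2.1).getD 0
    add_self := fun v => by
      funext a
      exact CharTwo.add_self_eq_zero (v a)
    vec_ne_zero := ?_
    vec_injOn := ?_
    exists_vec := ?_ }⟩
  · intro i k hk
    obtain ⟨p, hp, -⟩ := Option.map_eq_some_iff.1 hk
    simpa [hp] using p.2.2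
  · intro i j k hi hj hij
    obtain ⟨p, hp, hpk⟩ := Option.map_eq_some_iff.1 hi
    obtain ⟨p', hp', hpk'⟩ := Option.map_eq_some_iff.1 hj
    simp only [hp, hp', Option.map_some, Option.getD_some] at hij
    have : p = p' := Prod.ext (hpk.trans hpk'.symm) (Subtype.ext hij)
    rw [← (hg i p).1 hp, ← (hg j p').1 hp', this]
  · intro k v hv
    have := (hg (g (k, ⟨v, hv⟩)) (k, ⟨v, hv⟩)).2 rfl
    exact ⟨g (k, ⟨v, hv⟩), by simp [this], by simp [this]⟩

end CodeFamily

/-! ### Asymptotics and the main bound. -/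

theorem two_mul_numEdges_hypercube (n : ℕ) : 2 * numEdges (hypercube n) = n * 2 ^ n := by
  classical
  have hdeg : ∀ x, (hypercube n).degree x = n := by
    intro x
    have : (hypercube n).neighborFinset x = Finset.univ.image fun i => flipAt i x := by
      ext y
      simp [hypercube_adj_iff, eq_comm]
    rw [← SimpleGraph.card_neighborFinset_eq_degree, this,
      Finset.card_image_of_injective _ (flipAt_left_injective x)]
    simp
  have h := (hypercube n).sum_degrees_eq_twice_card_edges
  simp only [hdeg, Finset.sum_const, smul_eq_mul] at h
  rw [numEdges, ← SimpleGraph.coe_edgeFinset, Set.ncard_coe_finset, ← h]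
  simp [mul_comm]

theorem satNumber_le_numEdges {V W : Type*} [Finite V] (H : SimpleGraph V) (F : SimpleGraph W)
    (hF : F ≠ ⊥) : satNumber H F ≤ numEdges H := by
  obtain ⟨G, hG⟩ := exists_isSaturated H F hF
  have h1 : satNumber H F ≤ numEdges G := Nat.sInf_le ⟨G, hG, rfl⟩
  exact h1.trans (Set.ncard_le_ncard (SimpleGraph.edgeSet_mono hG.prop.1) (Set.toFinite _))

theorem satNumber_hypercube_le (q : ℕ) {n : ℕ} (hn : 1 ≤ n) :
    (satNumber (hypercube n) (hypercube (q + 1)) : ℝ) ≤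
      12 * q / √n * numEdges (hypercube n) := by
  have hn0 : (0 : ℝ) < n := by exact_mod_cast hn
  have hr : 0 < √(n : ℝ) := Real.sqrt_pos.2 hn0
  have hrr : √(n : ℝ) * √n = n := Real.mul_self_sqrt hn0.le
  -- This balances the two terms of the count: `√n / 2 ≤ 2 ^ t ≤ √n`.
  set t := Nat.log 4 n
  have hlow : (2 : ℝ) ^ t ≤ √n := by
    refine Real.le_sqrt_of_sq_le ?_
    rw [← pow_mul, mul_comm, pow_mul]
    norm_num
    exact_mod_cast Nat.pow_log_le_self 4 (by omega)
  have hupp : √n ≤ 2 * (2 : ℝ) ^ t := by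
    rw [← pow_succ']
    refine Real.sqrt_le_iff.2 ⟨by positivity, ?_⟩
    rw [← pow_mul, mul_comm, pow_mul]
    norm_num
    exact_mod_cast (Nat.lt_pow_succ_log_self (by norm_num : 1 < 4) n).le
  have hedges : (numEdges (hypercube n) : ℝ) = n * 2 ^ n / 2 := by
    rw [eq_div_iff two_ne_zero, mul_comm]
    exact_mod_cast two_mul_numEdges_hypercube n
  by_cases hroom : 2 * q * 2 ^ t ≤ n
  · obtain ⟨C⟩ := CodeFamily.nonempty_of_card_le hroom
    have h1 : (satNumber (hypercube n) (hypercube (q + 1)) : ℝ) ≤ C.exceptional.ncard := by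
      exact_mod_cast C.satNumber_le_ncard_exceptional
    refine (h1.trans C.ncard_exceptional_le).trans ?_
    have hcard : (Fintype.card (Fin t → ZMod 2) : ℝ) = 2 ^ t := by simp
    rw [hcard, hedges]
    have h2 : (n : ℝ) / 2 ^ t ≤ 2 * √n := by
      rw [div_le_iff₀ (by positivity)]
      nlinarith
    calc 2 * q * 2 ^ n * ((2 : ℝ) ^ t + n / 2 ^ t)
        ≤ 2 * q * 2 ^ n * (√n + 2 * √n) := by gcongr
      _ = 12 * q / √n * ((√n * √n) * 2 ^ n / 2) := by field_simp; ring
      _ = _ := by rw [hrr]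
  -- Without room for the blocks, `√n ≤ 2q`, and the trivial bound by `e(Q_n)` suffices.
  · push Not at hroom
    have h1 : (n : ℝ) < 2 * q * 2 ^ t := by exact_mod_cast hroom
    have h2 : (n : ℝ) ≤ 2 * q * √n := h1.le.trans (by gcongr)
    have h3 : √n ≤ 2 * q := by
      exact le_of_mul_le_mul_right (hrr.le.trans h2) hr
    have h4 : 1 ≤ 12 * q / √n := by
      rw [le_div_iff₀ hr]
      linarith [hr]
    have h5 : (satNumber (hypercube n) (hypercube (q + 1)) : ℝ) ≤ numEdges (hypercube n) := 
      Nat.cast_le.2 (satNumber_le_numEdges _ _ (hypercube_ne_bot (by omega)))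
    exact h5.trans (le_mul_of_one_le_left (Nat.cast_nonneg _) h4)

theorem mainTheorem1 :
    ∃ c a : ℕ → ℝ,
      a 1 = 1 ∧
      (∀ m : ℕ, 1 < m → a m = 1 / (7 * 3 ^ (m - 2))) ∧
      (∀ m : ℕ, 1 ≤ m → ∀ n : ℕ, 1 ≤ n →
        (satNumber (hypercube n) (hypercube m) : ℝ) ≤
          c m / (n : ℝ) ^ a m * (numEdges (hypercube n) : ℝ)) ∧
      (∀ m : ℕ, 1 ≤ m →
        Filter.Tendsto
          (fun n : ℕ => (satNumber (hypercube n) (hypercube m) : ℝ) / numEdges (hypercube n))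
          Filter.atTop (nhds 0)) := by
  set a : ℕ → ℝ := fun m => if m = 1 then 1 else 1 / (7 * 3 ^ (m - 2)) with ha
  set c : ℕ → ℝ := fun m => 12 * ((m - 1 : ℕ) : ℝ) with hc
  have hapos : ∀ m, 0 < a m := by
    intro m
    simp only [ha]
    split_ifs <;> positivity
  have hbound : ∀ m : ℕ, 1 ≤ m → ∀ n : ℕ, 1 ≤ n →
      (satNumber (hypercube n) (hypercube m) : ℝ) ≤
        c m / (n : ℝ) ^ a m * (numEdges (hypercube n) : ℝ) := by
    intro m hm n hn
    obtain ⟨q, rfl⟩ := Nat.exists_eq_add_of_le' hm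
    refine (satNumber_hypercube_le q hn).trans ?_
    simp only [hc, Nat.add_sub_cancel]
    -- For `m = 1` both constants vanish, so the exponent `a 1 = 1` costs nothing.
    rcases Nat.eq_zero_or_pos q with rfl | hq
    · simp
    have hn1 : (1 : ℝ) ≤ n := by exact_mod_cast hn
    have ha2 : a (q + 1) ≤ 1 / 2 := by
      simp only [ha, if_neg (show q + 1 ≠ 1 by omega)]
      have : (1 : ℝ) ≤ 3 ^ (q + 1 - 2) := one_le_pow₀ (by norm_num)
      exact one_div_le_one_div_of_le (by norm_num) (by linarith)
    rw [Real.sqrt_eq_rpow]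
    gcongr
  refine ⟨c, a, by simp [ha], fun m hm => by simp [ha, hm.ne'], hbound, fun m hm => ?_⟩
  have hlim : Filter.Tendsto (fun n : ℕ => c m / (n : ℝ) ^ a m) Filter.atTop (nhds 0) :=
    ((tendsto_rpow_atTop (hapos m)).comp tendsto_natCast_atTop_atTop).const_div_atTop (c m)
  refine squeeze_zero' (Filter.Eventually.of_forall fun n => by positivity) ?_ hlim
  filter_upwards [Filter.eventually_ge_atTop 1] with n hn
  have hc0 : 0 ≤ c m := by positivity
  exact div_le_of_le_mul₀ (by positivity) (by positivity) (hbound m hm n hn)
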